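/- Let $\mathbb{S}^2$ be the unit sphere in $\mathbb{R}^3$, and let $(V,E)$ be a connected simple graph embedded in $\mathbb{S}^2$ without self-intersections: distinct vertices are distinct points of $\mathbb{S}^2$, every edge is a simple curve connecting its two end vertices, and two different edges intersect only in the vertices they have in common. Assume that the embedding is locally compact, i.e. every compact $K\subseteq\mathbb{S}^2$ meets only finitely many edges. Let $F$ be the set of faces, i.e. of closures of connected components of $\mathbb{S}^2\setminus\bigcup E$. Assume that $G=(V,E,F)$ is a tessellation, that is: (T1) every edge is included in exactly two faces; (T2) any two distinct faces are either disjoint or intersect in exactly one vertex or exactly one edge; (T3) every face is homeomorphic to a closed disc. For $v\in V$ let $d_v$ be the number of edges emanating from $v$, for $f\in F$ let $\deg(f)$ be the number of edges contained in the boundary of $f$, and define the vertex curvature $$\Phi(v)=1-\frac{d_v}{2}+\sum_{f\in F,\ v\in f}\frac{1}{\deg(f)}.$$ Then $G$ admits some positive curvature: there is a vertex $v\in V$ with $\Phi(v)>0$. -/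

import Mathlib

/-- An embedding of the simple graph `G` into the space `S` without self-intersections: vertices
are distinct points, each edge is a simple curve connecting its end vertices, and two different
edges intersect only in the vertices they have in common.  (If every vertex is an end vertex of
some edge, it follows that an edge passes through no vertex other than its two end vertices.) -/
structure GraphEmbedding {V : Type*} (G : SimpleGraph V) (S : Type*) [TopologicalSpace S] where
  /-- the point of `S` that represents a vertex -/
  point : V → S
  /-- the curve in `S` that represents an edge, as a set of points -/
  curve : G.edgeSet → Set S
  point_injective : Function.Injective point
  curve_simple : ∀ ⦃x y : V⦄ (h : G.Adj x y),
    ∃ γ : Path (point x) (point y), Function.Injective γ ∧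
      Set.range γ = curve ⟨s(x, y), G.mem_edgeSet.mpr h⟩
  curve_inter : ∀ ⦃e e' : G.edgeSet⦄, e ≠ e' →
    curve e ∩ curve e' ⊆ point '' {v | v ∈ (e : Sym2 V) ∧ v ∈ (e' : Sym2 V)}

namespace GraphEmbedding

variable {V : Type*} {G : SimpleGraph V} {S : Type*} [TopologicalSpace S]

/-- The embedding is locally compact: every compact set meets only finitely many edges. -/
def IsLocallyCompact (E : GraphEmbedding G S) : Prop :=
  ∀ K : Set S, IsCompact K → {e : G.edgeSet | (E.curve e ∩ K).Nonempty}.Finite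

/-- The union of all edges, as a subset of the surface. -/
def skeleton (E : GraphEmbedding G S) : Set S :=
  ⋃ e : G.edgeSet, E.curve e

/-- The faces: the closures of the connected components of the complement of all edges. -/
def faces (E : GraphEmbedding G S) : Set (Set S) :=
  {f | ∃ x ∈ E.skeletonᶜ, f = closure (connectedComponentIn E.skeletonᶜ x)}

/-- A tessellation: (T1) every edge is included in two faces; (T2) every two faces are either
disjoint or intersect in one vertex or one edge; (T3) every face is homeomorphic to a closed
disc. -/
structure IsTessellation (E : GraphEmbedding G S) : Prop where
  edge_two_faces : ∀ e : G.edgeSet, {f ∈ E.faces | E.curve e ⊆ f}.ncard = 2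
  face_inter : ∀ f ∈ E.faces, ∀ g ∈ E.faces, f ≠ g →
    f ∩ g = ∅ ∨ (∃ v : V, f ∩ g = {E.point v}) ∨ (∃ e : G.edgeSet, f ∩ g = E.curve e)
  face_disc : ∀ f ∈ E.faces,
    Nonempty (f ≃ₜ Metric.closedBall (0 : EuclideanSpace ℝ (Fin 2)) 1)

/-- The degree of a vertex: the number of edges emanating from it. -/
noncomputable def vertexDegree (_E : GraphEmbedding G S) (v : V) : ℕ :=
  (G.incidenceSet v).ncard

/-- The degree of a face: the number of its boundary edges. -/
noncomputable def faceDegree (E : GraphEmbedding G S) (f : Set S) : ℕ :=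
  {e : G.edgeSet | E.curve e ⊆ frontier f}.ncard

/-- The vertex curvature `1 - d_v / 2 + ∑ 1 / deg f`, summed over the faces `f` containing `v`. -/
noncomputable def curvature (E : GraphEmbedding G S) (v : V) : ℝ :=
  1 - (E.vertexDegree v : ℝ) / 2
    + ∑ᶠ f ∈ {f ∈ E.faces | E.point v ∈ f}, 1 / (E.faceDegree f : ℝ)

end GraphEmbedding

/-! The curvature is summed over all vertices. Compactness of the sphere makes the edge set finite,
and connectedness then makes the vertex set finite, unless there are no edges and the claim is
immediate. The handshake lemma gives a total of |V| - |E| plus, for each face, its number of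
vertices divided by its degree. A face has at least as many vertices as boundary edges
(`faceDegree_le_ncard`), so the total is at least |V| - |E| + |F|. Hence the inequality |V| - |E| +
|F| ≥ 1, weaker than Euler's formula, suffices (`card_edges_add_one_le`).

That inequality is cohomological, with continuous logarithms of nonvanishing complex functions
playing the role of first cohomology. An integer function `c` on the edges defines a map from the
skeleton to the nonzero complex numbers which winds `c e` times along the edge `e`. If its degree
vanishes around every face boundary, its logarithms there extend over the faces. Exponentiating
gives a nonvanishing function on the sphere, which has a logarithm off one point. The values of this
logarithm at the vertices show that `c` is a coboundary (`exists_potential`). So the kernel of a map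
from ℤ^E to ℤ^F lies in the image of ℤ^V, whose rank is at most |V| - 1. The same count on a single
face boundary compares degree and vertices.

The topological input is that the frontier of a face is an embedded circle
(`exists_circle_eq_frontier`). This is invariance of domain for discs, again obtained from
logarithms, through separation properties of arcs and discs in the plane. -/

open Set Metric

/-! ### Continuous logarithms -/

/-- `g` has a continuous logarithm on `s`. -/
def HasLogOn {X : Type*} [TopologicalSpace X] (g : X → ℂ) (s : Set X) : Prop :=
  ∃ l : X → ℂ, ContinuousOn l s ∧ ∀ x ∈ s, Complex.exp (l x) = g x

namespace HasLogOn

variable {X Y : Type*} [TopologicalSpace X] [TopologicalSpace Y] {g h : X → ℂ} {s t : Set X}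

theorem mono (hg : HasLogOn g t) (hst : s ⊆ t) : HasLogOn g s :=
  let ⟨l, hl, hlg⟩ := hg
  ⟨l, hl.mono hst, fun x hx => hlg x (hst hx)⟩

theorem congr (hg : HasLogOn g s) (hgh : EqOn g h s) : HasLogOn h s :=
  let ⟨l, hl, hlg⟩ := hg
  ⟨l, hl, fun x hx => (hlg x hx).trans (hgh hx)⟩

theorem const {c : ℂ} (hc : c ≠ 0) : HasLogOn (fun _ : X => c) s :=
  ⟨fun _ => Complex.log c, continuousOn_const, fun _ _ => Complex.exp_log hc⟩

theorem mul (hg : HasLogOn g s) (hh : HasLogOn h s) : HasLogOn (fun x => g x * h x) s := by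
  obtain ⟨l, hl, hlg⟩ := hg
  obtain ⟨m, hm, hmh⟩ := hh
  exact ⟨fun x => l x + m x, hl.add hm, fun x hx => by rw [Complex.exp_add, hlg x hx, hmh x hx]⟩

theorem comp {φ : Y → X} {u : Set Y} (hg : HasLogOn g s) (hφ : ContinuousOn φ u)
    (hm : MapsTo φ u s) : HasLogOn (fun y => g (φ y)) u := by
  obtain ⟨l, hl, hlg⟩ := hg
  exact ⟨fun y => l (φ y), hl.comp hφ hm, fun y hy => hlg _ (hm hy)⟩

/-- Homotopy lifting: a nonvanishing homotopy transports a continuous logarithm. -/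
theorem of_homotopy (H : ℝ → X → ℂ)
    (hc : ContinuousOn (fun p : ℝ × X => H p.1 p.2) (Icc 0 1 ×ˢ s))
    (hne : ∀ r ∈ Icc (0 : ℝ) 1, ∀ x ∈ s, H r x ≠ 0) (h0 : HasLogOn (H 0) s) :
    HasLogOn (H 1) s := by
  classical
  obtain ⟨l, hl, hlg⟩ := h0
  have hK : Continuous (fun p : unitInterval × s => H p.1 p.2) :=
    hc.comp_continuous (f := fun p : unitInterval × s => ((p.1 : ℝ), (p.2 : X)))
      (by fun_prop) (fun p => ⟨p.1.2, p.2.2⟩)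
  let K : C(unitInterval × s, {z : ℂ // z ≠ 0}) :=
    ⟨fun p => ⟨H p.1 p.2, hne _ p.1.2 _ p.2.2⟩, hK.subtype_mk _⟩
  let f : C(s, ℂ) := ⟨fun x => l x, hl.domRestrict⟩
  have hK0 : ∀ a, K (0, a) = ⟨Complex.exp (f a), Complex.exp_ne_zero _⟩ := by
    intro a
    ext
    exact (hlg a a.2).symm
  let F := Complex.isCoveringMap_exp.liftHomotopy K f hK0
  have hF : ∀ p, Complex.exp (F p) = H p.1 p.2 := fun p =>
    congrArg Subtype.val (congrFun (Complex.isCoveringMap_exp.liftHomotopy_lifts K f hK0) p)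
  refine ⟨fun x => if hx : x ∈ s then F (1, ⟨x, hx⟩) else 0, ?_, fun x hx => ?_⟩
  · rw [continuousOn_iff_continuous_domRestrict]
    have : s.domRestrict (fun x => if hx : x ∈ s then F (1, ⟨x, hx⟩) else 0)
        = fun x : s => F (1, x) := by
      ext x; simp [Set.domRestrict_apply]
    rw [this]
    fun_prop
  · simp only [hx, dif_pos]
    simpa using hF (1, ⟨x, hx⟩)

/-- Nonvanishing continuous functions on sets that are star-shaped about a point `c` of the set
have continuous logarithms. -/
theorem of_starConvex {E : Type*} [NormedAddCommGroup E] [NormedSpace ℝ E] {g : E → ℂ} {s : Set E}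
    {c : E} (hs : StarConvex ℝ c s) (hg : ContinuousOn g s) (hne : ∀ x ∈ s, g x ≠ 0) :
    HasLogOn g s := by
  rcases s.eq_empty_or_nonempty with rfl | hsn
  · exact ⟨0, continuousOn_empty _, fun x hx => hx.elim⟩
  have hcs : c ∈ s := hs.mem hsn
  have hmem : ∀ r ∈ Icc (0 : ℝ) 1, ∀ x ∈ s, c + r • (x - c) ∈ s := fun r hr x hx =>
    hs.add_smul_sub_mem hx hr.1 hr.2
  have := of_homotopy (s := s) (fun r x => g (c + r • (x - c))) ?_
    (fun r hr x hx => hne _ (hmem r hr x hx)) ?_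
  · simpa using this
  · exact hg.comp (by fun_prop) (fun p hp => hmem _ hp.1 _ hp.2)
  · simpa using HasLogOn.const (hne c hcs)

end HasLogOn

/-- Two continuous logarithms on a preconnected set differ by a constant. -/
theorem IsPreconnected.exists_eq_add_of_exp_eq {X : Type*} [TopologicalSpace X] {s : Set X}
    (hs : IsPreconnected s) {l m : X → ℂ} (hl : ContinuousOn l s) (hm : ContinuousOn m s)
    (h : ∀ x ∈ s, Complex.exp (l x) = Complex.exp (m x)) :
    ∃ c, Complex.exp c = 1 ∧ ∀ x ∈ s, l x = m x + c := by
  rcases s.eq_empty_or_nonempty with rfl | ⟨a, ha⟩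
  · exact ⟨0, Complex.exp_zero, fun x hx => hx.elim⟩
  have hone : ∀ x ∈ s, Complex.exp (l x - m x) = 1 := fun x hx => by
    rw [Complex.exp_sub, h x hx, div_self (Complex.exp_ne_zero _)]
  -- The difference of the logarithms maps into the fibre of `exp` over 1, which is discrete.
  have hd := (Complex.isCoveringMap_exp ⟨1, one_ne_zero⟩).1
  refine ⟨l a - m a, hone a ha, fun x hx => ?_⟩
  have := hs.constant_of_mapsTo ⟨hd⟩ (hl.sub hm)
    (fun x hx => show (l x - m x) ∈ _ from Subtype.ext (hone x hx)) hx ha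
  simp only [Pi.sub_apply] at this
  rw [← this]; ring

/-! ### Separation of the plane -/

/-- The winding of a circle about its centre: `x - a` has no continuous logarithm there. -/
theorem not_hasLogOn_sphere (a : ℂ) {r : ℝ} (hr : 0 < r) :
    ¬ HasLogOn (fun x => x - a) (sphere a r) := by
  rintro ⟨l, hl, hla⟩
  let p : ℝ → ℂ := fun t => circleMap a r t
  have hp : ∀ t, p t ∈ sphere a r := fun t => circleMap_mem_sphere a hr.le t
  have hpc : Continuous p := continuous_circleMap a r
  obtain ⟨c, -, hc⟩ := isPreconnected_univ.exists_eq_add_of_exp_eq (s := univ)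
    (l := fun t => l (p t)) (m := fun t : ℝ => Complex.log r + t * Complex.I)
    (hl.comp_continuous hpc hp).continuousOn (by fun_prop) (by
      intro t _
      rw [hla _ (hp t), Complex.exp_add, Complex.exp_log (by exact_mod_cast hr.ne')]
      simp [p, circleMap])
  have h0 := hc 0 trivial
  have h1 := hc (2 * Real.pi) trivial
  have h2 : p (2 * Real.pi) = p 0 := by
    simp [p, circleMap]
  rw [h2, h0] at h1
  have : (2 * Real.pi : ℂ) * Complex.I = 0 := by
    push_cast at h1
    linear_combination -h1
  simp [Real.pi_ne_zero] at this

theorem isPreconnected_compl_closedBall {R : ℝ} (hR : 0 < R) :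
    IsPreconnected (closedBall (0 : ℂ) R)ᶜ := by
  have h : (closedBall (0 : ℂ) R)ᶜ = Complex.exp '' {z | Real.log R < z.re} := by
    ext x
    simp only [mem_compl_iff, mem_closedBall_zero_iff, not_le, mem_image, mem_ofPred_eq]
    constructor
    · intro hx
      have hx0 : x ≠ 0 := norm_pos_iff.mp (hR.trans hx)
      exact ⟨Complex.log x, by rw [Complex.log_re]; exact Real.log_lt_log hR hx,
        Complex.exp_log hx0⟩
    · rintro ⟨z, hz, rfl⟩
      rw [Complex.norm_exp]
      exact (Real.log_lt_iff_lt_exp hR).mp hz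
  rw [h]
  exact (convex_halfSpace_re_gt _).isPreconnected.image _ Complex.continuous_exp.continuousOn

/-- A compact subset of the plane all of whose nonvanishing functions have logarithms does not
separate the plane. -/
theorem IsCompact.isPreconnected_compl_of_hasLogOn {f : Set ℂ} (hf : IsCompact f)
    (hlog : ∀ g : ℂ → ℂ, ContinuousOn g f → (∀ x ∈ f, g x ≠ 0) → HasLogOn g f) :
    IsPreconnected fᶜ := by
  classical
  -- Borsuk's argument: on a bounded component `W` around `q`, replace `x - q` by the exponential of
  -- a Tietze extension of its logarithm on `f`. The result vanishes nowhere in the plane, so it has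
  -- a logarithm; yet it still equals `x - q` on a large circle.
  have hunb : ∀ q ∈ fᶜ, ¬ Bornology.IsBounded (connectedComponentIn fᶜ q) := by
    intro q hq hb
    set W := connectedComponentIn fᶜ q with hW
    have hqW : q ∈ W := mem_connectedComponentIn hq
    have hWo : IsOpen W := hf.isClosed.isOpen_compl.connectedComponentIn
    have hfr : frontier W ⊆ f := by
      intro x hx
      by_contra hxf
      have hV : IsOpen (connectedComponentIn fᶜ x) :=
        hf.isClosed.isOpen_compl.connectedComponentIn
      obtain ⟨y, hy, hyW⟩ := mem_closure_iff.mp hx.1 _ hV (mem_connectedComponentIn hxf)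
      have h1 := connectedComponentIn_eq hy
      have h2 := connectedComponentIn_eq hyW
      refine hx.2 ?_
      rw [hWo.interior_eq, hW, h2, ← h1]
      exact mem_connectedComponentIn hxf
    obtain ⟨l, hl, hle⟩ := hlog (fun x => x - q) (by fun_prop)
      (fun x hx h => hq (by rwa [← sub_eq_zero.mp h]))
    obtain ⟨m, hm⟩ := ContinuousMap.exists_extension hf.isClosed.isClosedEmbedding_subtypeVal
      ⟨f.domRestrict l, hl.domRestrict⟩
    have hml : ∀ x ∈ f, m x = l x := fun x hx => DFunLike.congr_fun hm ⟨x, hx⟩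
    let H : ℂ → ℂ := W.piecewise (fun x => Complex.exp (m x)) (fun x => x - q)
    have hH : Continuous H := Continuous.piecewise
      (fun x hx => by rw [hml x (hfr hx), hle x (hfr hx)]) (by fun_prop) (by fun_prop)
    have hlogH : HasLogOn H univ := HasLogOn.of_starConvex (c := 0) (starConvex_univ _)
      hH.continuousOn (by
        intro x _
        by_cases hx : x ∈ W
        · simp [H, hx, Complex.exp_ne_zero]
        · simp only [H, hx, not_false_eq_true, piecewise_eq_of_notMem]
          exact fun h => hx (by rwa [sub_eq_zero.mp h]))
    obtain ⟨R, hR, hWR⟩ := hb.subset_ball_lt 0 q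
    refine not_hasLogOn_sphere q hR ((hlogH.mono (subset_univ _)).congr fun x hx => ?_)
    have hxW : x ∉ W := fun h => by
      have := hWR h
      rw [mem_ball] at this
      exact this.ne (mem_sphere.mp hx)
    simp [H, hxW]
  obtain ⟨R, hR0, hR⟩ := hf.isBounded.subset_closedBall_lt 0 0
  have hout : IsPreconnected (closedBall (0 : ℂ) R)ᶜ := isPreconnected_compl_closedBall hR0
  have hsub : (closedBall (0 : ℂ) R)ᶜ ⊆ fᶜ := compl_subset_compl.mpr hR
  have hmeet : ∀ q ∈ fᶜ, ∃ x ∈ (closedBall (0 : ℂ) R)ᶜ, x ∈ connectedComponentIn fᶜ q := by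
    intro q hq
    by_contra! h
    exact hunb q hq (isBounded_closedBall.subset fun x hx => by_contra fun hx' => h x hx' hx)
  refine isPreconnected_of_forall_pair fun x hx y hy => ?_
  obtain ⟨x', hx', hxx⟩ := hmeet x hx
  obtain ⟨y', hy', hyy⟩ := hmeet y hy
  refine ⟨connectedComponentIn fᶜ x, connectedComponentIn_subset _ _,
    mem_connectedComponentIn hx, ?_, isPreconnected_connectedComponentIn⟩
  have hsame : connectedComponentIn fᶜ x' = connectedComponentIn fᶜ y' :=
    connectedComponentIn_eq (hout.subset_connectedComponentIn hx' hsub hy')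
  rw [connectedComponentIn_eq hxx, hsame, ← connectedComponentIn_eq hyy]
  exact mem_connectedComponentIn hy

/-- The quotient `(x - a) / (x - b)` has a logarithm off any path from `b` to `a`. -/
theorem hasLogOn_compl_path {α : ℝ → ℂ} (hα : ContinuousOn α (Icc 0 1)) :
    HasLogOn (fun x => (x - α 1) / (x - α 0)) (α '' Icc 0 1)ᶜ := by
  have hne : ∀ r ∈ Icc (0 : ℝ) 1, ∀ x ∈ (α '' Icc 0 1)ᶜ, x - α r ≠ 0 := by
    intro r hr x hx h
    exact hx ⟨r, hr, (sub_eq_zero.mp h).symm⟩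
  have h0 : (0 : ℝ) ∈ Icc (0 : ℝ) 1 := by simp
  refine HasLogOn.of_homotopy (fun r x => (x - α r) / (x - α 0)) ?_ ?_ ?_
  · refine ContinuousOn.div ?_ (by fun_prop) (fun p hp => hne 0 h0 _ hp.2)
    exact continuousOn_snd.sub (hα.comp continuousOn_fst fun p hp => hp.1)
  · exact fun r hr x hx => div_ne_zero (hne r hr x hx) (hne 0 h0 x hx)
  · exact (HasLogOn.const one_ne_zero).congr fun x hx => (div_self (hne 0 h0 x hx)).symm

/-- Two arcs that share exactly their end points separate the plane. -/
theorem not_isPreconnected_compl_union_paths {α β : ℝ → ℂ} (hα : ContinuousOn α (Icc 0 1))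
    (hβ : ContinuousOn β (Icc 0 1)) (h0 : β 0 = α 0) (h1 : β 1 = α 1) (hne : α 0 ≠ α 1)
    (hint : α '' Icc 0 1 ∩ β '' Icc 0 1 ⊆ {α 0, α 1}) :
    ¬ IsPreconnected (α '' Icc 0 1 ∪ β '' Icc 0 1)ᶜ := by
  classical
  intro hpre
  set A := α '' Icc 0 1
  set B := β '' Icc 0 1
  set a := α 1
  set b := α 0
  have hAc : IsClosed A := (isCompact_Icc.image_of_continuousOn hα).isClosed
  have hBc : IsClosed B := (isCompact_Icc.image_of_continuousOn hβ).isClosed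
  obtain ⟨l, hl, hle⟩ := hasLogOn_compl_path hα
  obtain ⟨m, hm, hme⟩ := hasLogOn_compl_path hβ
  rw [h0, h1] at hme
  have hsubA : (A ∪ B)ᶜ ⊆ Aᶜ := compl_subset_compl.mpr subset_union_left
  have hsubB : (A ∪ B)ᶜ ⊆ Bᶜ := compl_subset_compl.mpr subset_union_right
  obtain ⟨c, hc, hlm⟩ := hpre.exists_eq_add_of_exp_eq (hl.mono hsubA) (hm.mono hsubB)
    (fun x hx => by rw [hle x (hsubA hx), hme x (hsubB hx)])
  -- If the complement of both arcs were connected, the two logarithms would differ there by a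
  -- constant `c`. Correcting one by `c` glues them across both arcs away from the end points.
  have hlog : HasLogOn (fun x => (x - a) / (x - b)) {a, b}ᶜ := by
    refine ⟨fun x => if x ∈ A then m x + c else l x, fun x hx => ?_, fun x hx => ?_⟩
    · refine ContinuousAt.continuousWithinAt ?_
      by_cases hxA : x ∈ A
      · have hxB : x ∉ B := fun hxB => hx (by simpa [or_comm] using hint ⟨hxA, hxB⟩)
        have hn : Bᶜ ∈ nhds x := hBc.isOpen_compl.mem_nhds hxB
        refine ((hm.continuousAt hn).add (continuousAt_const (y := c))).congr ?_
        filter_upwards [hn] with y hy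
        by_cases hyA : y ∈ A
        · simp [hyA]
        · simp [hyA, hlm y (fun h => h.elim hyA hy)]
      · have hn : Aᶜ ∈ nhds x := hAc.isOpen_compl.mem_nhds hxA
        refine (hl.continuousAt hn).congr ?_
        filter_upwards [hn] with y hy
        simp [show y ∉ A from hy]
    · by_cases hxA : x ∈ A
      · have hxB : x ∉ B := fun hxB => hx (by simpa [or_comm] using hint ⟨hxA, hxB⟩)
        simp only [hxA, if_true, Complex.exp_add, hc, mul_one]
        exact hme x hxB
      · simp only [hxA, if_false]
        exact hle x hxA
  have hd : 0 < dist b a := dist_pos.mpr hne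
  have hb : b ∉ closedBall a (dist b a / 2) := by
    rw [mem_closedBall]; linarith
  -- Near `a` the denominator has a logarithm, so multiplying by it would give one for `x - a` on a
  -- circle about `a`.
  have hlog2 : HasLogOn (fun x => x - b) (closedBall a (dist b a / 2)) :=
    HasLogOn.of_starConvex
      ((convex_closedBall a _).starConvex (mem_closedBall_self (by positivity))) (by fun_prop)
      (fun x hx h => hb (sub_eq_zero.mp h ▸ hx))
  have hsph : sphere a (dist b a / 2) ⊆ {a, b}ᶜ := by
    rintro x hx (rfl | rfl)
    · rw [mem_sphere, dist_self] at hx; linarith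
    · exact hb (sphere_subset_closedBall hx)
  refine not_hasLogOn_sphere a (half_pos hd)
    (((hlog.mono hsph).mul (hlog2.mono sphere_subset_closedBall)).congr fun x hx => ?_)
  exact div_mul_cancel₀ _ fun h => hb (by
    have h' := sphere_subset_closedBall hx
    rwa [show x = b from sub_eq_zero.mp h] at h')

/-! ### Embedded closed discs in the plane -/

/-- The inverse of a continuous injection of a compact set is continuous. -/
theorem IsCompact.continuousOn_invFunOn {X Y : Type*} [TopologicalSpace X] [Nonempty X]
    [TopologicalSpace Y] [T2Space Y] {ψ : X → Y} {s : Set X} (hs : IsCompact s)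
    (hc : ContinuousOn ψ s) (hi : InjOn ψ s) :
    ContinuousOn (Function.invFunOn ψ s) (ψ '' s) := by
  refine continuousOn_iff_isClosed.mpr fun t ht => ⟨ψ '' (t ∩ s), ?_, ?_⟩
  · exact ((hs.inter_left ht).image_of_continuousOn (hc.mono inter_subset_right)).isClosed
  · ext y
    constructor
    · rintro ⟨hy, x, hx, rfl⟩
      rw [mem_preimage, hi.leftInvOn_invFunOn hx] at hy
      exact ⟨⟨x, ⟨hy, hx⟩, rfl⟩, x, hx, rfl⟩
    · rintro ⟨⟨x, ⟨hxt, hx⟩, rfl⟩, -⟩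
      exact ⟨by rw [mem_preimage, hi.leftInvOn_invFunOn hx]; exact hxt, x, hx, rfl⟩

/-- Logarithms can be transported along continuous injections of compact sets. -/
theorem HasLogOn.image_of_isCompact {X Y : Type*} [TopologicalSpace X] [Nonempty X]
    [TopologicalSpace Y] [T2Space Y] {ψ : X → Y} {s : Set X} (hs : IsCompact s)
    (hc : ContinuousOn ψ s) (hi : InjOn ψ s) {g : Y → ℂ}
    (hg : HasLogOn (fun x => g (ψ x)) s) : HasLogOn g (ψ '' s) :=
  (hg.comp (hs.continuousOn_invFunOn hc hi) fun _ hx => Function.invFunOn_mem hx).congr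
    fun x hx => by simp only [Function.invFunOn_eq hx]

section ClosedDisc

variable {ψ : ℂ → ℂ} (hc : ContinuousOn ψ (closedBall 0 1)) (hi : InjOn ψ (closedBall 0 1))
include hc hi

/-- Boundary points of an embedded closed disc are not interior points. -/
theorem notMem_interior_of_mem_sphere {a : ℂ} (ha : a ∈ sphere (0 : ℂ) 1) :
    ψ a ∉ interior (ψ '' closedBall 0 1) := by
  intro hint
  obtain ⟨r, hr, hrs⟩ := nhds_basis_closedBall.mem_iff.mp (mem_interior_iff_mem_nhds.mp hint)
  have haD : a ∈ closedBall (0 : ℂ) 1 := sphere_subset_closedBall ha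
  -- Removing a boundary point keeps the disc star-shaped, so `ψ z - ψ a` has a logarithm there; a
  -- small circle about `ψ a` inside the image contradicts this.
  have hstar : StarConvex ℝ (0 : ℂ) (closedBall 0 1 \ {a}) := by
    rw [starConvex_zero_iff]
    rintro x ⟨hx, hxa⟩ t ht0 ht1
    have hx1 : ‖x‖ ≤ 1 := by simpa using hx
    have ha1 : ‖a‖ = 1 := by simpa using ha
    refine ⟨?_, fun h => ?_⟩
    · rw [mem_closedBall_zero_iff, norm_smul, Real.norm_of_nonneg ht0]
      nlinarith [norm_nonneg x]
    · have h' : t • x = a := h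
      have : t * ‖x‖ = 1 := by rw [← ha1, ← h', norm_smul, Real.norm_of_nonneg ht0]
      have ht : t = 1 := by nlinarith [norm_nonneg x]
      exact hxa (by simpa [ht] using h')
  have hlog : HasLogOn (fun z => ψ z - ψ a) (closedBall 0 1 \ {a}) :=
    HasLogOn.of_starConvex hstar ((hc.mono sdiff_subset).sub continuousOn_const)
      (fun z hz h => hz.2 (hi hz.1 haD (sub_eq_zero.mp h)))
  have hsub : sphere (ψ a) r ⊆ ψ '' closedBall 0 1 := sphere_subset_closedBall.trans hrs
  refine not_hasLogOn_sphere (ψ a) hr (HasLogOn.congr (hlog.comp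
    (((isCompact_closedBall 0 1).continuousOn_invFunOn hc hi).mono hsub)
    fun x hx => ⟨?_, fun h => ?_⟩)
    fun x hx => ?_)
  · exact Function.invFunOn_mem (hsub hx)
  · have := Function.invFunOn_eq (hsub hx)
    rw [h] at this
    rw [← this, mem_sphere, dist_self] at hx
    exact hr.ne hx
  · simp only [Function.invFunOn_eq (hsub hx)]

/-- Logarithms exist on the star-shaped disc and are carried to its image, so Borsuk's criterion
applies. -/
theorem isPreconnected_compl_image_closedBall : IsPreconnected (ψ '' closedBall 0 1)ᶜ := by
  refine ((isCompact_closedBall 0 1).image_of_continuousOn hc).isPreconnected_compl_of_hasLogOn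
    fun g hg hne => ?_
  have hlog : HasLogOn (fun z => g (ψ z)) (closedBall 0 1) :=
    HasLogOn.of_starConvex
      ((convex_closedBall (0 : ℂ) 1).starConvex (mem_closedBall_self zero_le_one))
      (hg.comp hc (mapsTo_image _ _)) (fun z hz => hne _ (mem_image_of_mem _ hz))
  exact hlog.image_of_isCompact (isCompact_closedBall 0 1) hc hi

/-- The image of the unit circle under an embedding of the disc separates the plane. -/
theorem not_isPreconnected_compl_image_sphere : ¬ IsPreconnected (ψ '' sphere 0 1)ᶜ := by
  -- The circle is cut at 1 and -1 into its upper and lower halves, `p t` and `p (-t)` for `t` in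
  -- [0, 1].
  let p : ℝ → ℂ := fun t => circleMap 0 1 (Real.pi * t)
  have hp : ∀ t, p t ∈ sphere (0 : ℂ) 1 := fun t => circleMap_mem_sphere 0 zero_le_one _
  have hpD : ∀ t, p t ∈ closedBall (0 : ℂ) 1 := fun t => sphere_subset_closedBall (hp t)
  have hpc : Continuous p := (continuous_circleMap 0 1).comp (by fun_prop)
  have hpre : ∀ t, (p t).re = Real.cos (Real.pi * t) := fun t => by
    rw [← Complex.exp_ofReal_mul_I_re]; simp [p, circleMap]
  have hpim : ∀ t, (p t).im = Real.sin (Real.pi * t) := fun t => by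
    rw [← Complex.exp_ofReal_mul_I_im]; simp [p, circleMap]
  have hp0 : p 0 = 1 := by simp [p, circleMap]
  have hp1 : p 1 = -1 := by simp [p, circleMap]
  have hpm1 : p (-1) = -1 := by
    apply Complex.ext <;> simp [hpre, hpim]
  have key := not_isPreconnected_compl_union_paths
    (α := fun t => ψ (p t)) (β := fun t => ψ (p (-t)))
    (hc.comp hpc.continuousOn fun t _ => hpD t)
    (hc.comp (hpc.comp continuous_neg).continuousOn fun t _ => hpD _) (by simp)
    (by simp [hp1, hpm1]) (fun h => by
      have := hi (hpD 0) (hpD 1) h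
      rw [hp0, hp1] at this
      norm_num [Complex.ext_iff] at this) (by
      rintro _ ⟨⟨s, hs, rfl⟩, t, ht, hst⟩
      have h := hi (hpD _) (hpD _) hst
      have him := congrArg Complex.im h
      rw [hpim, hpim, mul_neg, Real.sin_neg] at him
      have h1 : 0 ≤ Real.sin (Real.pi * t) := Real.sin_nonneg_of_nonneg_of_le_pi
        (mul_nonneg Real.pi_pos.le ht.1) (mul_le_of_le_one_right Real.pi_pos.le ht.2)
      have h2 : 0 ≤ Real.sin (Real.pi * s) := Real.sin_nonneg_of_nonneg_of_le_pi
        (mul_nonneg Real.pi_pos.le hs.1) (mul_le_of_le_one_right Real.pi_pos.le hs.2)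
      have h3 : Real.sin (Real.pi * s) = 0 := by linarith
      rcases hs.1.eq_or_lt with rfl | hs0
      · simp
      rcases hs.2.eq_or_lt with rfl | hs1
      · simp
      · have := Real.sin_pos_of_pos_of_lt_pi (mul_pos Real.pi_pos hs0)
          (mul_lt_of_lt_one_right Real.pi_pos hs1)
        linarith)
  convert key using 3
  ext y
  constructor
  · rintro ⟨z, hz, rfl⟩
    have hz1 : ‖z‖ = 1 := by simpa using hz
    have hzp : p (z.arg / Real.pi) = z := by
      have := Complex.norm_mul_exp_arg_mul_I z
      simp only [p, circleMap, mul_div_cancel₀ _ Real.pi_ne_zero]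
      rw [hz1] at this
      simpa using this
    have hle : z.arg / Real.pi ≤ 1 := (div_le_one Real.pi_pos).mpr (Complex.arg_le_pi z)
    have hge : -1 ≤ z.arg / Real.pi := by
      rw [le_div_iff₀ Real.pi_pos]
      linarith [Complex.neg_pi_lt_arg z]
    rcases le_total 0 (z.arg / Real.pi) with h | h
    · exact Or.inl ⟨_, ⟨h, hle⟩, by simp only [hzp]⟩
    · exact Or.inr ⟨-(z.arg / Real.pi), ⟨by linarith, by linarith⟩, by simp only [neg_neg, hzp]⟩
  · rintro (⟨t, -, rfl⟩ | ⟨t, -, rfl⟩)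
    · exact mem_image_of_mem _ (hp _)
    · exact mem_image_of_mem _ (hp _)

/-- Invariance of domain for the disc: interior points of an embedded disc are interior. -/
theorem mem_interior_of_mem_ball {z : ℂ} (hz : z ∈ ball (0 : ℂ) 1) :
    ψ z ∈ interior (ψ '' closedBall 0 1) := by
  by_contra hint
  have hcl : ψ z ∈ closure (ψ '' closedBall 0 1)ᶜ := by
    rwa [closure_compl]
  -- The point `ψ z` would link the connected exterior to the connected image of the open disc,
  -- making the complement of the boundary curve connected.
  have h1 : IsPreconnected (insert (ψ z) (ψ '' closedBall 0 1)ᶜ) :=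
    (isPreconnected_compl_image_closedBall hc hi).subset_closure (subset_insert _ _)
      (insert_subset hcl subset_closure)
  have h2 : IsPreconnected (ψ '' ball 0 1) :=
    (convex_ball (0 : ℂ) 1).isPreconnected.image _ (hc.mono ball_subset_closedBall)
  have h3 := h2.union (ψ z) (mem_image_of_mem _ hz) (mem_insert _ _) h1
  refine not_isPreconnected_compl_image_sphere hc hi ?_
  convert h3 using 1
  ext y
  constructor
  · intro hy
    by_cases hyD : y ∈ ψ '' closedBall 0 1
    · obtain ⟨w, hw, rfl⟩ := hyD
      refine Or.inl ⟨w, ?_, rfl⟩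
      rw [← ball_union_sphere] at hw
      exact hw.resolve_right fun h => hy ⟨w, h, rfl⟩
    · exact Or.inr (Or.inr hyD)
  · rintro (⟨w, hw, rfl⟩ | rfl | hy) ⟨u, hu, huw⟩
    · have := hi (sphere_subset_closedBall hu) (ball_subset_closedBall hw) huw
      rw [this] at hu
      exact sphere_disjoint_ball.le_bot ⟨hu, hw⟩
    · have := hi (sphere_subset_closedBall hu) (ball_subset_closedBall hz) huw
      rw [this] at hu
      exact sphere_disjoint_ball.le_bot ⟨hu, hz⟩
    · exact hy ⟨u, sphere_subset_closedBall hu, huw⟩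

end ClosedDisc

/-! ### Degree of functions on the unit circle -/

theorem exists_log_circleMap {g : ℂ → ℂ} (hg : ContinuousOn g (sphere 0 1))
    (hne : ∀ x ∈ sphere (0 : ℂ) 1, g x ≠ 0) :
    ∃ l : ℝ → ℂ, Continuous l ∧ ∀ t, Complex.exp (l t) = g (circleMap 0 1 t) := by
  have hm : ∀ t, circleMap 0 1 t ∈ sphere (0 : ℂ) 1 := fun t => circleMap_mem_sphere 0 zero_le_one t
  obtain ⟨l, hl, hle⟩ := HasLogOn.of_starConvex (E := ℝ) (g := fun t => g (circleMap 0 1 t))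
    (starConvex_univ (0 : ℝ)) (hg.comp_continuous (continuous_circleMap 0 1) hm).continuousOn
    (fun t _ => hne _ (hm t))
  exact ⟨l, continuousOn_univ.mp hl, fun t => hle t trivial⟩

theorem exists_log_circleMap_add {g : ℂ → ℂ} {l : ℝ → ℂ} (hl : Continuous l)
    (hle : ∀ t, Complex.exp (l t) = g (circleMap 0 1 t)) :
    ∃ n : ℤ, ∀ t, l (t + 2 * Real.pi) = l t + n * (2 * Real.pi * Complex.I) := by
  obtain ⟨c, hc, h⟩ := isPreconnected_univ.exists_eq_add_of_exp_eq (s := univ)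
    (l := fun t => l (t + 2 * Real.pi)) (m := l) (by fun_prop) hl.continuousOn (by
      intro t _
      rw [hle, hle, periodic_circleMap])
  obtain ⟨n, hn⟩ := Complex.exp_eq_one_iff.mp hc
  exact ⟨n, fun t => by rw [h t trivial, hn]⟩

open Classical in
/-- The degree of a nonvanishing continuous function on the unit circle. -/
noncomputable def circleDegree (g : ℂ → ℂ) : ℤ :=
  if h : ∃ n : ℤ, ∃ l : ℝ → ℂ, Continuous l ∧ (∀ t, Complex.exp (l t) = g (circleMap 0 1 t)) ∧
    ∀ t, l (t + 2 * Real.pi) = l t + n * (2 * Real.pi * Complex.I)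
  then h.choose else 0

/-- Two lifts differ by a constant, which cancels in the increment over a period; the choice in the
definition is harmless. -/
theorem circleDegree_eq {g : ℂ → ℂ} {l : ℝ → ℂ} {n : ℤ} (hl : Continuous l)
    (hle : ∀ t, Complex.exp (l t) = g (circleMap 0 1 t))
    (hn : ∀ t, l (t + 2 * Real.pi) = l t + n * (2 * Real.pi * Complex.I)) :
    circleDegree g = n := by
  have h : ∃ n : ℤ, ∃ l : ℝ → ℂ, Continuous l ∧
      (∀ t, Complex.exp (l t) = g (circleMap 0 1 t)) ∧
      ∀ t, l (t + 2 * Real.pi) = l t + n * (2 * Real.pi * Complex.I) := ⟨n, l, hl, hle, hn⟩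
  obtain ⟨m, hm, hme, hmn⟩ := h.choose_spec
  obtain ⟨c, -, hlm⟩ := isPreconnected_univ.exists_eq_add_of_exp_eq (s := univ)
    hl.continuousOn hm.continuousOn (fun t _ => by rw [hle, hme])
  rw [circleDegree, dif_pos h]
  have h1 := hn 0
  have h2 := hmn 0
  rw [hlm _ trivial, hlm 0 trivial, h2] at h1
  have h3 : (h.choose : ℂ) * (2 * Real.pi * Complex.I) = n * (2 * Real.pi * Complex.I) := by
    linear_combination h1
  exact_mod_cast mul_right_cancel₀ Complex.two_pi_I_ne_zero h3

theorem circleDegree_mul {g h : ℂ → ℂ} (hg : ContinuousOn g (sphere 0 1))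
    (hg0 : ∀ x ∈ sphere (0 : ℂ) 1, g x ≠ 0) (hh : ContinuousOn h (sphere 0 1))
    (hh0 : ∀ x ∈ sphere (0 : ℂ) 1, h x ≠ 0) :
    circleDegree (fun x => g x * h x) = circleDegree g + circleDegree h := by
  obtain ⟨l, hl, hle⟩ := exists_log_circleMap hg hg0
  obtain ⟨m, hm, hme⟩ := exists_log_circleMap hh hh0
  obtain ⟨a, ha⟩ := exists_log_circleMap_add hl hle
  obtain ⟨b, hb⟩ := exists_log_circleMap_add hm hme
  rw [circleDegree_eq hl hle ha, circleDegree_eq hm hme hb]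
  refine circleDegree_eq (hl.add hm) (fun t => by simp [Complex.exp_add, hle, hme]) (fun t => ?_)
  simp only [Pi.add_apply, ha, hb]
  push_cast
  ring

/-- A nonvanishing function of degree zero on the unit circle has a logarithm. -/
theorem hasLogOn_sphere_of_circleDegree_eq_zero {g : ℂ → ℂ} (hg : ContinuousOn g (sphere 0 1))
    (hg0 : ∀ x ∈ sphere (0 : ℂ) 1, g x ≠ 0) (h : circleDegree g = 0) :
    HasLogOn g (sphere 0 1) := by
  obtain ⟨l, hl, hle⟩ := exists_log_circleMap hg hg0
  obtain ⟨n, hn⟩ := exists_log_circleMap_add hl hle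
  rw [circleDegree_eq hl hle hn] at h
  subst h
  have hper : Function.Periodic l (2 * Real.pi) := fun t => by simpa using hn t
  have hcm : ∀ x ∈ sphere (0 : ℂ) 1, circleMap 0 1 x.arg = x := by
    intro x hx
    have h1 : ‖x‖ = 1 := by simpa using hx
    have := Complex.norm_mul_exp_arg_mul_I x
    rw [h1] at this
    simpa [circleMap] using this
  -- `arg` jumps on the negative axis; this second expression for the same function is continuous
  -- there.
  have hrot : ∀ x ∈ sphere (0 : ℂ) 1, l x.arg = l ((-x).arg + Real.pi) := by
    intro x hx
    have hx' : -x ∈ sphere (0 : ℂ) 1 := by simpa using hx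
    have h2 : circleMap 0 1 x.arg = circleMap 0 1 ((-x).arg + Real.pi) := by
      have h3 := hcm _ hx'
      simp only [circleMap, zero_add, Complex.ofReal_one, one_mul] at h3
      rw [hcm x hx, circleMap]
      push_cast
      rw [add_mul, Complex.exp_add, Complex.exp_pi_mul_I, h3]
      simp
    obtain ⟨k, hk⟩ := (circleMap_eq_circleMap_iff 0 one_ne_zero).mp h2
    have hk' : x.arg = (-x).arg + Real.pi + k * (2 * Real.pi) := by
      have h5 : (x.arg : ℂ) * Complex.I
          = (((-x).arg + Real.pi + k * (2 * Real.pi) : ℝ) : ℂ) * Complex.I := by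
        rw [hk]; push_cast; ring
      exact_mod_cast mul_right_cancel₀ Complex.I_ne_zero h5
    rw [hk']
    exact hper.int_mul k _
  refine ⟨fun x => l x.arg, fun x hx => ?_, fun x hx => by rw [hle, hcm x hx]⟩
  have hx0 : x ≠ 0 := by rintro rfl; simp at hx
  by_cases hs : x ∈ Complex.slitPlane
  · exact (hl.continuousAt.comp (Complex.continuousAt_arg hs)).continuousWithinAt
  · have hs' : -x ∈ Complex.slitPlane :=
      (Complex.mem_slitPlane_or_neg_mem_slitPlane hx0).resolve_left hs
    have h4 : ContinuousAt (fun y : ℂ => l ((-y).arg + Real.pi)) x :=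
      hl.continuousAt.comp (((Complex.continuousAt_arg hs').comp
        continuous_neg.continuousAt).add continuousAt_const)
    exact h4.continuousWithinAt.congr (fun y hy => hrot y hy) (hrot x hx)

/-! ### Discs and logarithms on the sphere -/

section Sphere

/-- The stereographic projection from `v` onto the complex plane. -/
noncomputable def complexStereographic (v : sphere (0 : EuclideanSpace ℝ (Fin 3)) 1) :
    OpenPartialHomeomorph (sphere (0 : EuclideanSpace ℝ (Fin 3)) 1) ℂ :=
  haveI : Fact (Module.finrank ℝ (EuclideanSpace ℝ (Fin 3)) = 2 + 1) := ⟨by simp⟩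
  (stereographic' 2 v).trans
    Complex.orthonormalBasisOneI.repr.symm.toHomeomorph.toOpenPartialHomeomorph

theorem complexStereographic_source (v : sphere (0 : EuclideanSpace ℝ (Fin 3)) 1) :
    (complexStereographic v).source = {v}ᶜ := by
  simp [complexStereographic]

theorem complexStereographic_target (v : sphere (0 : EuclideanSpace ℝ (Fin 3)) 1) :
    (complexStereographic v).target = univ := by
  simp [complexStereographic]

variable {φ : ℂ → sphere (0 : EuclideanSpace ℝ (Fin 3)) 1}
  (hc : ContinuousOn φ (closedBall 0 1)) (hi : InjOn φ (closedBall 0 1))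
include hc hi

/-- The frontier of a closed disc that is embedded as a proper subset of the sphere is the image
of the unit circle. -/
theorem frontier_image_closedBall (hne : φ '' closedBall 0 1 ≠ univ) :
    frontier (φ '' closedBall 0 1) = φ '' sphere 0 1 := by
  -- Stereographic projection from a missed point reduces the claim to discs in the plane.
  obtain ⟨v, hv⟩ := (ne_univ_iff_exists_notMem _).mp hne
  set e := complexStereographic v
  have hsrc : φ '' closedBall 0 1 ⊆ e.source := by
    rw [complexStereographic_source]
    exact fun x hx h => hv (h ▸ hx)
  have hmem : MapsTo φ (closedBall 0 1) e.source := fun z hz => hsrc (mem_image_of_mem _ hz)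
  have hψc : ContinuousOn (fun z => e (φ z)) (closedBall 0 1) := e.continuousOn.comp hc hmem
  have hψi : InjOn (fun z => e (φ z)) (closedBall 0 1) := fun z hz w hw h =>
    hi hz hw (e.injOn (hmem hz) (hmem hw) h)
  have himg : e.IsImage (φ '' closedBall 0 1) ((fun z => e (φ z)) '' closedBall 0 1) := by
    intro x hx
    constructor
    · rintro ⟨z, hz, hzx⟩
      exact ⟨z, hz, e.injOn (hmem hz) hx hzx⟩
    · rintro ⟨z, hz, rfl⟩
      exact ⟨z, hz, rfl⟩
  have hint : ∀ z ∈ closedBall (0 : ℂ) 1, (φ z ∈ interior (φ '' closedBall 0 1) ↔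
      e (φ z) ∈ interior ((fun z => e (φ z)) '' closedBall 0 1)) := fun z hz =>
    (himg.interior (hmem hz)).symm
  have hcl : IsClosed (φ '' closedBall 0 1) :=
    ((isCompact_closedBall 0 1).image_of_continuousOn hc).isClosed
  rw [hcl.frontier_eq]
  ext x
  constructor
  · rintro ⟨⟨z, hz, rfl⟩, hzi⟩
    refine ⟨z, ?_, rfl⟩
    have hz' := hz
    rw [← ball_union_sphere] at hz'
    exact hz'.resolve_left fun h => hzi ((hint z hz).mpr (mem_interior_of_mem_ball hψc hψi h))
  · rintro ⟨z, hz, rfl⟩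
    have hz' := sphere_subset_closedBall hz
    exact ⟨mem_image_of_mem _ hz',
      fun h => notMem_interior_of_mem_sphere hψc hψi hz ((hint z hz').mp h)⟩

omit hc hi in
/-- A nonvanishing function on the sphere has a logarithm off any given point. -/
theorem hasLogOn_compl_singleton {h : sphere (0 : EuclideanSpace ℝ (Fin 3)) 1 → ℂ}
    (hh : Continuous h)
    (hne : ∀ x, h x ≠ 0) (v : sphere (0 : EuclideanSpace ℝ (Fin 3)) 1) :
    HasLogOn h {v}ᶜ := by
  set e := complexStereographic v
  have hsym : Continuous e.symm := by
    have := e.continuousOn_symm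
    rwa [complexStereographic_target, continuousOn_univ] at this
  have hlog : HasLogOn (fun z => h (e.symm z)) univ :=
    HasLogOn.of_starConvex (starConvex_univ (0 : ℂ)) (hh.comp hsym).continuousOn (fun z _ => hne _)
  have hs : e.source = {v}ᶜ := complexStereographic_source v
  refine (hlog.comp (u := {v}ᶜ) (hs ▸ e.continuousOn) (fun _ _ => trivial)).congr fun x hx => ?_
  have : e.symm (e x) = x := e.left_inv (hs ▸ hx)
  simp only [this]

end Sphere

/-! ### Rank count -/

/-- If every integral edge function in the kernel of `M` is the coboundary of a vertex function,
then the number of edges is less than the number of vertices plus the rank of the target. -/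
theorem card_add_one_le_of_ker_le_coboundary {V E F : Type*} [Fintype V] [Fintype E] [Fintype F]
    [Nonempty V] (src tgt : E → V) (M : (E → ℤ) →ₗ[ℤ] (F → ℤ))
    (h : ∀ c, M c = 0 → ∃ g : V → ℤ, ∀ e, c e = g (tgt e) - g (src e)) :
    Fintype.card E + 1 ≤ Fintype.card V + Fintype.card F := by
  let δ : (V → ℤ) →ₗ[ℤ] (E → ℤ) := LinearMap.funLeft ℤ ℤ tgt - LinearMap.funLeft ℤ ℤ src
  have hker : LinearMap.ker M ≤ LinearMap.range δ := by
    intro c hc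
    obtain ⟨g, hg⟩ := h c hc
    exact ⟨g, funext fun e => by simp [δ, hg, LinearMap.funLeft_apply]⟩
  have h1 := (LinearMap.ker M).finrank_quotient_add_finrank
  have h2 := (LinearMap.ker δ).finrank_quotient_add_finrank
  rw [M.quotKerEquivRange.finrank_eq] at h1
  rw [δ.quotKerEquivRange.finrank_eq] at h2
  have h3 : Module.finrank ℤ (LinearMap.range M) ≤ Fintype.card F := by
    simpa using Submodule.finrank_le (LinearMap.range M)
  have h4 : Module.finrank ℤ (LinearMap.ker M) ≤ Module.finrank ℤ (LinearMap.range δ) :=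
    Submodule.finrank_mono hker
  -- Constant functions have zero coboundary; this is the source of the `+ 1`.
  have h5 : 0 < Module.finrank ℤ (LinearMap.ker δ) := by
    have hm : (fun _ => 1 : V → ℤ) ∈ LinearMap.ker δ := by
      rw [LinearMap.mem_ker]; ext e; simp [δ, LinearMap.funLeft_apply]
    have : Nontrivial (LinearMap.ker δ) :=
      ⟨⟨⟨_, hm⟩, 0, fun h => by
        simpa using congrFun (congrArg Subtype.val h) (Classical.arbitrary V)⟩⟩
    exact Module.finrank_pos
  simp only [Module.finrank_fintype_fun_eq_card] at h1 h2
  omega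

/-! ### Winding maps on the skeleton -/

namespace GraphEmbedding

variable {V : Type*} {G : SimpleGraph V} {S : Type*} [TopologicalSpace S]

/-- The first end vertex of an edge, in an arbitrary orientation. -/
noncomputable def edgeSource (e : G.edgeSet) : V := (Quot.out (e : Sym2 V)).1

/-- The second end vertex of an edge, in an arbitrary orientation. -/
noncomputable def edgeTarget (e : G.edgeSet) : V := (Quot.out (e : Sym2 V)).2

theorem mk_edgeSource_edgeTarget (e : G.edgeSet) : s(edgeSource e, edgeTarget e) = (e : Sym2 V) :=
  Quot.out_eq _

theorem adj_edgeSource_edgeTarget (e : G.edgeSet) : G.Adj (edgeSource e) (edgeTarget e) := by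
  rw [← SimpleGraph.mem_edgeSet, mk_edgeSource_edgeTarget]
  exact e.2

variable (E : GraphEmbedding G S)

/-- An injective parametrization of an edge. -/
noncomputable def edgePath (e : G.edgeSet) :
    Path (E.point (edgeSource e)) (E.point (edgeTarget e)) :=
  (E.curve_simple (adj_edgeSource_edgeTarget e)).choose

theorem edgePath_injective (e : G.edgeSet) : Function.Injective (E.edgePath e) :=
  (E.curve_simple (adj_edgeSource_edgeTarget e)).choose_spec.1

theorem range_edgePath (e : G.edgeSet) : range (E.edgePath e) = E.curve e := by
  rw [edgePath, (E.curve_simple (adj_edgeSource_edgeTarget e)).choose_spec.2]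
  congr 1
  exact Subtype.ext (mk_edgeSource_edgeTarget e)

theorem edgePath_mem_curve (e : G.edgeSet) (t : unitInterval) : E.edgePath e t ∈ E.curve e :=
  E.range_edgePath e ▸ mem_range_self t

theorem point_source_mem_curve (e : G.edgeSet) : E.point (edgeSource e) ∈ E.curve e := by
  simpa using E.edgePath_mem_curve e 0

theorem point_target_mem_curve (e : G.edgeSet) : E.point (edgeTarget e) ∈ E.curve e := by
  simpa using E.edgePath_mem_curve e 1

theorem curve_subset_skeleton (e : G.edgeSet) : E.curve e ⊆ E.skeleton :=
  subset_iUnion E.curve e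

theorem isCompact_curve (e : G.edgeSet) : IsCompact (E.curve e) :=
  E.range_edgePath e ▸ isCompact_range (E.edgePath e).continuous

theorem isCompact_skeleton [Finite G.edgeSet] : IsCompact E.skeleton :=
  isCompact_iUnion E.isCompact_curve

theorem eq_point_of_mem_curve_of_mem_curve {e e' : G.edgeSet} (hne : e ≠ e') {x : S}
    (hx : x ∈ E.curve e) (hx' : x ∈ E.curve e') :
    x = E.point (edgeSource e) ∨ x = E.point (edgeTarget e) := by
  obtain ⟨v, ⟨hv, -⟩, rfl⟩ := E.curve_inter hne ⟨hx, hx'⟩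
  rw [← mk_edgeSource_edgeTarget, Sym2.mem_iff] at hv
  exact hv.imp (congrArg _) (congrArg _)

open Classical in
/-- The map that winds an edge once around the unit circle and is `1` elsewhere. -/
noncomputable def winding (e : G.edgeSet) (x : S) : ℂ :=
  if x ∈ E.curve e then
    Complex.exp (2 * Real.pi * Complex.I * (Function.invFun (E.edgePath e) x : unitInterval))
  else 1

theorem winding_ne_zero (e : G.edgeSet) (x : S) : E.winding e x ≠ 0 := by
  rw [winding]; split_ifs
  exacts [Complex.exp_ne_zero _, one_ne_zero]

theorem winding_edgePath (e : G.edgeSet) (t : unitInterval) :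
    E.winding e (E.edgePath e t) = Complex.exp (2 * Real.pi * Complex.I * t) := by
  rw [winding, if_pos (E.edgePath_mem_curve e t),
    Function.leftInverse_invFun (E.edgePath_injective e)]

theorem winding_source (e : G.edgeSet) : E.winding e (E.point (edgeSource e)) = 1 := by
  simpa using E.winding_edgePath e 0

theorem winding_target (e : G.edgeSet) : E.winding e (E.point (edgeTarget e)) = 1 := by
  simpa using E.winding_edgePath e 1

theorem winding_of_mem_curve {e e' : G.edgeSet} (hne : e ≠ e') {x : S} (hx : x ∈ E.curve e') :
    E.winding e x = 1 := by
  by_cases h : x ∈ E.curve e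
  · rcases E.eq_point_of_mem_curve_of_mem_curve hne h hx with rfl | rfl
    exacts [E.winding_source e, E.winding_target e]
  · rw [winding, if_neg h]

theorem continuousOn_winding [T2Space S] [Finite G.edgeSet] (e : G.edgeSet) :
    ContinuousOn (E.winding e) E.skeleton := by
  refine (locallyFinite_of_finite _).continuousOn_iUnion
    (fun e' => (E.isCompact_curve e').isClosed) fun e' => ?_
  by_cases hne : e = e'
  · subst hne
    have hemb : Topology.IsEmbedding (E.edgePath e) :=
      ((E.edgePath e).continuous.isClosedEmbedding (E.edgePath_injective e)).isEmbedding
    rw [← E.range_edgePath e, continuousOn_iff_continuous_domRestrict,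
      ← hemb.toHomeomorph.comp_continuous_iff']
    have : (range (E.edgePath e)).domRestrict (E.winding e) ∘ hemb.toHomeomorph
        = fun t : unitInterval => Complex.exp (2 * Real.pi * Complex.I * t) :=
      funext fun t => E.winding_edgePath e t
    rw [this]
    fun_prop
  · exact continuousOn_const.congr fun x hx => E.winding_of_mem_curve hne hx

section Chain

variable [Fintype G.edgeSet]

/-- The map on the skeleton that winds every edge `e` around the unit circle `c e` times. -/
noncomputable def chainMap (c : G.edgeSet → ℤ) (x : S) : ℂ := ∏ e, E.winding e x ^ c e

theorem chainMap_ne_zero (c : G.edgeSet → ℤ) (x : S) : E.chainMap c x ≠ 0 :=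
  Finset.prod_ne_zero_iff.mpr fun e _ => zpow_ne_zero _ (E.winding_ne_zero e x)

theorem chainMap_add (c d : G.edgeSet → ℤ) (x : S) :
    E.chainMap (c + d) x = E.chainMap c x * E.chainMap d x := by
  simp only [chainMap, ← Finset.prod_mul_distrib, Pi.add_apply]
  exact Finset.prod_congr rfl fun e _ => zpow_add₀ (E.winding_ne_zero e x) _ _

theorem continuousOn_chainMap [T2Space S] (c : G.edgeSet → ℤ) :
    ContinuousOn (E.chainMap c) E.skeleton :=
  continuousOn_finsetProd _ fun e _ =>
    (E.continuousOn_winding e).zpow₀ _ fun x _ => Or.inl (E.winding_ne_zero e x)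

theorem chainMap_edgePath (c : G.edgeSet → ℤ) (e : G.edgeSet) (t : unitInterval) :
    E.chainMap c (E.edgePath e t) = Complex.exp (c e * (2 * Real.pi * Complex.I * t)) := by
  rw [chainMap, Finset.prod_eq_single e, winding_edgePath, Complex.exp_int_mul]
  · intro e' _ hne
    rw [E.winding_of_mem_curve hne (E.edgePath_mem_curve e t), one_zpow]
  · simp

/-- If the map winding every edge `e` around `c e` times has a logarithm, then `c` is the
coboundary of an integral function on the vertices. -/
theorem exists_potential_of_hasLogOn {c : G.edgeSet → ℤ} {s : Set S}
    (h : HasLogOn (E.chainMap c) s) :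
    ∃ g : V → ℤ, ∀ e, E.curve e ⊆ s → c e = g (edgeTarget e) - g (edgeSource e) := by
  classical
  obtain ⟨l, hl, hle⟩ := h
  -- At a vertex of an edge in `s` the chain map equals 1, so the logarithm is an integer multiple
  -- of 2πi; the default 0 is never used for such vertices.
  let g : V → ℤ := fun v =>
    if hv : ∃ n : ℤ, l (E.point v) = n * (2 * Real.pi * Complex.I) then hv.choose else 0
  have hg : ∀ v, Complex.exp (l (E.point v)) = 1 →
      l (E.point v) = g v * (2 * Real.pi * Complex.I) := by
    intro v hv
    have hn := Complex.exp_eq_one_iff.mp hv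
    simp only [g, dif_pos hn]
    exact hn.choose_spec
  refine ⟨g, fun e hes => ?_⟩
  have hm : ∀ t, E.edgePath e t ∈ s := fun t => hes (E.edgePath_mem_curve e t)
  obtain ⟨a, -, ha⟩ := isPreconnected_univ.exists_eq_add_of_exp_eq (s := univ)
    (l := fun t => l (E.edgePath e t))
    (m := fun t : unitInterval => c e * (2 * Real.pi * Complex.I * t))
    (hl.comp_continuous (E.edgePath e).continuous hm).continuousOn (by fun_prop)
    (fun t _ => by rw [hle _ (hm t), chainMap_edgePath])
  have h0 := ha 0 trivial
  have h1 := ha 1 trivial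
  have e0 := hle _ (hm 0)
  have e1 := hle _ (hm 1)
  rw [chainMap_edgePath] at e0 e1
  simp only [Path.source, Path.target, Icc.coe_zero, Icc.coe_one,
    Complex.ofReal_zero, Complex.ofReal_one, mul_zero, mul_one, zero_add, Complex.exp_zero,
    Complex.exp_int_mul_two_pi_mul_I] at h0 h1 e0 e1
  rw [hg _ e0] at h0
  rw [hg _ e1, ← h0] at h1
  have h2 : (c e : ℂ) * (2 * Real.pi * Complex.I)
      = (g (edgeTarget e) - g (edgeSource e)) * (2 * Real.pi * Complex.I) := by
    linear_combination -h1
  exact_mod_cast mul_right_cancel₀ Complex.two_pi_I_ne_zero h2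

/-- The degree of `chainMap` along a closed curve in the skeleton, as a functional. -/
noncomputable def chainDegree [T2Space S] (φ : ℂ → S) (hφ : ContinuousOn φ (sphere 0 1))
    (hm : MapsTo φ (sphere 0 1) E.skeleton) : (G.edgeSet → ℤ) →ₗ[ℤ] ℤ :=
  (AddMonoidHom.mk' (fun c => circleDegree fun z => E.chainMap c (φ z)) fun c d => by
    simp only [chainMap_add]
    exact circleDegree_mul ((E.continuousOn_chainMap c).comp hφ hm)
      (fun _ _ => E.chainMap_ne_zero _ _) ((E.continuousOn_chainMap d).comp hφ hm)
      (fun _ _ => E.chainMap_ne_zero _ _)).toIntLinearMap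

theorem hasLogOn_of_chainDegree_eq_zero [T2Space S] {φ : ℂ → S}
    (hφ : ContinuousOn φ (sphere 0 1)) (hm : MapsTo φ (sphere 0 1) E.skeleton)
    {c : G.edgeSet → ℤ} (h : E.chainDegree φ hφ hm c = 0) :
    HasLogOn (fun z => E.chainMap c (φ z)) (sphere 0 1) :=
  hasLogOn_sphere_of_circleDegree_eq_zero ((E.continuousOn_chainMap c).comp hφ hm)
    (fun _ _ => E.chainMap_ne_zero _ _) h

end Chain

end GraphEmbedding

/-! ### Faces of a tessellation -/

namespace GraphEmbedding

variable {V : Type*} {G : SimpleGraph V} {S : Type*} [TopologicalSpace S]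
  {E : GraphEmbedding G S}

theorem isClosed_of_mem_faces {f : Set S} (hf : f ∈ E.faces) : IsClosed f := by
  obtain ⟨x, -, rfl⟩ := hf
  exact isClosed_closure

theorem exists_mem_faces_of_notMem_skeleton {x : S} (hx : x ∉ E.skeleton) :
    closure (connectedComponentIn E.skeletonᶜ x) ∈ E.faces := ⟨x, hx, rfl⟩

namespace IsTessellation

variable (hT : E.IsTessellation)
include hT

theorem exists_face_ne (e : G.edgeSet) (f : Set S) : ∃ g ∈ E.faces, g ≠ f ∧ E.curve e ⊆ g := by
  obtain ⟨g, ⟨hg, heg⟩, hne⟩ := exists_ne_of_one_lt_ncard (a := f)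
    (by rw [hT.edge_two_faces e]; norm_num : 1 < {f ∈ E.faces | E.curve e ⊆ f}.ncard)
  exact ⟨g, hg, hne, heg⟩

theorem iUnion_faces [Nonempty G.edgeSet] : ⋃ f : E.faces, (f : Set S) = univ := by
  refine eq_univ_of_forall fun x => mem_iUnion.mpr ?_
  by_cases hx : x ∈ E.skeleton
  · obtain ⟨e, he⟩ := mem_iUnion.mp hx
    obtain ⟨g, hg, -, heg⟩ := hT.exists_face_ne e ∅
    exact ⟨⟨g, hg⟩, heg he⟩
  · exact ⟨⟨_, exists_mem_faces_of_notMem_skeleton hx⟩,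
      subset_closure (mem_connectedComponentIn hx)⟩

theorem finite_faces [Finite G.edgeSet]
    (h : ∀ f ∈ E.faces, ∃ e, E.curve e ⊆ f) : E.faces.Finite := by
  -- Since `ncard` is 0 on infinite sets, the value 2 in (T1) also yields finiteness.
  refine (finite_iUnion fun e : G.edgeSet => finite_of_ncard_ne_zero
    (s := {f ∈ E.faces | E.curve e ⊆ f}) ?_).subset fun f hf => ?_
  · rw [hT.edge_two_faces e]; norm_num
  · obtain ⟨e, he⟩ := h f hf
    exact mem_iUnion.mpr ⟨e, hf, he⟩

variable [T2Space S] [LocallyConnectedSpace S] [Finite G.edgeSet]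

omit hT in
theorem _root_.GraphEmbedding.connectedComponentIn_eq_of_mem_closure {x y : S}
    (hx : x ∈ E.skeletonᶜ) (h : x ∈ closure (connectedComponentIn E.skeletonᶜ y)) :
    connectedComponentIn E.skeletonᶜ x = connectedComponentIn E.skeletonᶜ y := by
  have ho : IsOpen (connectedComponentIn E.skeletonᶜ x) :=
    E.isCompact_skeleton.isClosed.isOpen_compl.connectedComponentIn
  obtain ⟨z, hzx, hzy⟩ := mem_closure_iff.mp h _ ho (mem_connectedComponentIn hx)
  rw [connectedComponentIn_eq hzx, connectedComponentIn_eq hzy]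

omit hT in
theorem _root_.GraphEmbedding.eq_closure_of_mem_face {f : Set S} (hf : f ∈ E.faces) {x : S}
    (hxf : x ∈ f) (hx : x ∉ E.skeleton) :
    f = closure (connectedComponentIn E.skeletonᶜ x) := by
  obtain ⟨y, -, rfl⟩ := hf
  rw [connectedComponentIn_eq_of_mem_closure hx hxf]

/-- Components of the complement are open, so a frontier point lies on an edge. Conversely, by (T1)
a point on an edge lies in a face `g ≠ f`; were it interior to `f`, the component defining `g` would
meet `f` off the skeleton, forcing `g = f`. -/
theorem frontier_face {f : Set S} (hf : f ∈ E.faces) : frontier f = f ∩ E.skeleton := by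
  rw [(isClosed_of_mem_faces hf).frontier_eq]
  ext x
  refine and_congr_right fun hxf => ⟨fun hx => ?_, fun hx hxi => ?_⟩
  · by_contra hxK
    refine hx (mem_interior.mpr ⟨connectedComponentIn E.skeletonᶜ x, ?_,
      E.isCompact_skeleton.isClosed.isOpen_compl.connectedComponentIn,
      mem_connectedComponentIn hxK⟩)
    rw [eq_closure_of_mem_face hf hxf hxK]
    exact subset_closure
  · obtain ⟨e, he⟩ := mem_iUnion.mp hx
    obtain ⟨g, hg, hne, heg⟩ := hT.exists_face_ne e f
    obtain ⟨y, hy, rfl⟩ := id hg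
    obtain ⟨z, hzf, hzy⟩ := mem_closure_iff.mp (heg he) _ isOpen_interior hxi
    have hz : z ∉ E.skeleton := connectedComponentIn_subset _ _ hzy
    exact hne ((eq_closure_of_mem_face hg (subset_closure hzy) hz).trans
      (eq_closure_of_mem_face hf (interior_subset hzf) hz).symm)

theorem curve_subset_frontier_iff {f : Set S} (hf : f ∈ E.faces) (e : G.edgeSet) :
    E.curve e ⊆ frontier f ↔ E.curve e ⊆ f := by
  rw [hT.frontier_face hf, subset_inter_iff, and_iff_left (E.curve_subset_skeleton e)]

theorem face_ne_univ [Nonempty G.edgeSet] {f : Set S} (hf : f ∈ E.faces) : f ≠ univ := by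
  rintro rfl
  have h := hT.frontier_face hf
  rw [frontier_univ, univ_inter] at h
  obtain ⟨e⟩ := ‹Nonempty G.edgeSet›
  exact (h ▸ E.curve_subset_skeleton e (E.point_source_mem_curve e) : _ ∈ (∅ : Set S))

/-- A face with infinite frontier contains an edge. -/
theorem exists_curve_subset_face [Finite V] {f : Set S} (hf : f ∈ E.faces)
    (hinf : (frontier f).Infinite) : ∃ e, E.curve e ⊆ f := by
  by_contra! h
  -- If `f` contains no edge, (T2) leaves only vertices as intersections with other faces, so the
  -- frontier is finite.
  refine hinf ((finite_range E.point).subset fun x hx => ?_)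
  rw [hT.frontier_face hf] at hx
  obtain ⟨e, he⟩ := mem_iUnion.mp hx.2
  obtain ⟨g, hg, hne, heg⟩ := hT.exists_face_ne e f
  have hxfg : x ∈ f ∩ g := ⟨hx.1, heg he⟩
  rcases hT.face_inter f hf g hg hne.symm with h0 | ⟨v, hv⟩ | ⟨e', he'⟩
  · rw [h0] at hxfg; exact hxfg.elim
  · rw [hv] at hxfg; exact ⟨v, hxfg.symm⟩
  · exact (h e' (he' ▸ inter_subset_left)).elim

end IsTessellation

/-! ### Euler inequality and total curvature -/

section Sphere

variable {E : GraphEmbedding G (sphere (0 : EuclideanSpace ℝ (Fin 3)) 1)}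

instance locallyConnectedSpace_sphere :
    LocallyConnectedSpace (sphere (0 : EuclideanSpace ℝ (Fin 3)) 1) :=
  haveI : Fact (Module.finrank ℝ (EuclideanSpace ℝ (Fin 3)) = 2 + 1) := ⟨by simp⟩
  ChartedSpace.locallyConnectedSpace (EuclideanSpace ℝ (Fin 2)) _

namespace IsTessellation

variable (hT : E.IsTessellation)
include hT

/-- The frontier of a face is an embedded circle. -/
theorem exists_circle_eq_frontier [Finite G.edgeSet] [Nonempty G.edgeSet]
    {f : Set (sphere (0 : EuclideanSpace ℝ (Fin 3)) 1)} (hf : f ∈ E.faces) :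
    ∃ φ : ℂ → sphere (0 : EuclideanSpace ℝ (Fin 3)) 1, ContinuousOn φ (sphere 0 1) ∧
      InjOn φ (sphere 0 1) ∧ φ '' sphere 0 1 = frontier f := by
  classical
  obtain ⟨η⟩ := hT.face_disc f hf
  let ι := Complex.orthonormalBasisOneI.repr
  have hι : ∀ z ∈ closedBall (0 : ℂ) 1,
      ι z ∈ closedBall (0 : EuclideanSpace ℝ (Fin 2)) 1 := fun z hz => by simpa using hz
  let φ : ℂ → sphere (0 : EuclideanSpace ℝ (Fin 3)) 1 := fun z =>
    if hz : z ∈ closedBall (0 : ℂ) 1 then η.symm ⟨ι z, hι z hz⟩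
    else E.point (edgeSource (Classical.arbitrary G.edgeSet))
  have hφ : ∀ z (hz : z ∈ closedBall (0 : ℂ) 1), φ z = η.symm ⟨ι z, hι z hz⟩ :=
    fun z hz => dif_pos hz
  have hc : ContinuousOn φ (closedBall 0 1) := by
    rw [continuousOn_iff_continuous_domRestrict]
    have : (closedBall (0 : ℂ) 1).domRestrict φ
        = fun z : closedBall (0 : ℂ) 1 =>
          (η.symm ⟨ι z, hι z z.2⟩ : sphere (0 : EuclideanSpace ℝ (Fin 3)) 1) :=
      funext fun z => hφ z z.2
    rw [this]
    fun_prop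
  have hi : InjOn φ (closedBall 0 1) := by
    intro z hz w hw h
    rw [hφ z hz, hφ w hw] at h
    exact ι.injective (congrArg Subtype.val (η.symm.injective (Subtype.ext h)))
  have himg : φ '' closedBall 0 1 = f := by
    ext x
    constructor
    · rintro ⟨z, hz, rfl⟩
      rw [hφ z hz]
      exact Subtype.coe_prop _
    · intro hx
      have hz : ι.symm (η ⟨x, hx⟩) ∈ closedBall (0 : ℂ) 1 := by
        rw [mem_closedBall_zero_iff, ι.symm.norm_map]
        exact mem_closedBall_zero_iff.mp (η ⟨x, hx⟩).2
      exact ⟨_, hz, by rw [hφ _ hz]; simp⟩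
  refine ⟨φ, hc.mono sphere_subset_closedBall, hi.mono sphere_subset_closedBall, ?_⟩
  rw [← frontier_image_closedBall hc hi (himg ▸ hT.face_ne_univ hf), himg]

theorem infinite_frontier_face [Finite G.edgeSet] [Nonempty G.edgeSet]
    {f : Set (sphere (0 : EuclideanSpace ℝ (Fin 3)) 1)} (hf : f ∈ E.faces) :
    (frontier f).Infinite := by
  obtain ⟨φ, -, hi, hφ⟩ := hT.exists_circle_eq_frontier hf
  rw [← hφ]
  refine Infinite.image hi (IsPreconnected.infinite_of_nontrivial ?_ ?_)
  · exact isPreconnected_sphere (by simp [Complex.rank_real_complex]) 0 1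
  · exact ⟨1, by simp, -1, by simp, by norm_num [Complex.ext_iff]⟩

/-- If the winding map of `c` has a logarithm on the frontier of every face, then `c` is a
coboundary. -/
theorem exists_potential [Fintype G.edgeSet] [Nonempty G.edgeSet] (hfin : E.faces.Finite)
    {c : G.edgeSet → ℤ} (h : ∀ f ∈ E.faces, HasLogOn (E.chainMap c) (frontier f)) :
    ∃ g : V → ℤ, ∀ e, c e = g (edgeTarget e) - g (edgeSource e) := by
  classical
  have hext : ∀ f ∈ E.faces, ∃ m : C(sphere (0 : EuclideanSpace ℝ (Fin 3)) 1, ℂ),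
      ∀ x ∈ frontier f, Complex.exp (m x) = E.chainMap c x := by
    intro f hf
    obtain ⟨l, hl, hle⟩ := h f hf
    obtain ⟨m, hm⟩ := ContinuousMap.exists_extension
      (isClosed_frontier (s := f)).isClosedEmbedding_subtypeVal
      ⟨(frontier f).domRestrict l, hl.domRestrict⟩
    exact ⟨m, fun x hx => by rw [show m x = l x from DFunLike.congr_fun hm ⟨x, hx⟩, hle x hx]⟩
  choose! m hm using hext
  -- Off the skeleton, a point uses the extended logarithm of its unique face; on frontiers this
  -- agrees with the chain map.
  let k : sphere (0 : EuclideanSpace ℝ (Fin 3)) 1 → ℂ := fun x =>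
    if x ∈ E.skeleton then E.chainMap c x
    else Complex.exp (m (closure (connectedComponentIn E.skeletonᶜ x)) x)
  have hkf : ∀ f ∈ E.faces, EqOn k (fun x => Complex.exp (m f x)) f := by
    intro f hf x hx
    by_cases hxK : x ∈ E.skeleton
    · have hfr : x ∈ frontier f := by rw [hT.frontier_face hf]; exact ⟨hx, hxK⟩
      simp only [k, if_pos hxK, hm f hf x hfr]
    · simp only [k, if_neg hxK, ← eq_closure_of_mem_face hf hx hxK]
  have hkc : Continuous k := by
    have := hfin.to_subtype
    refine (locallyFinite_of_finite fun f : E.faces => (f : Set _)).continuous hT.iUnion_faces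
      (fun f => isClosed_of_mem_faces f.2) fun f => ?_
    exact ContinuousOn.congr (by fun_prop) (hkf f f.2)
  have hk0 : ∀ x, k x ≠ 0 := by
    intro x
    simp only [k]
    split_ifs
    exacts [E.chainMap_ne_zero c x, Complex.exp_ne_zero _]
  -- The puncture must avoid the skeleton, so that the logarithm is defined on all edges.
  obtain ⟨v, hv⟩ : ∃ v, v ∉ E.skeleton := by
    obtain ⟨g, ⟨v, hv, -⟩, -⟩ := hT.exists_face_ne (Classical.arbitrary G.edgeSet) ∅
    exact ⟨v, hv⟩
  have hlog : HasLogOn (E.chainMap c) E.skeleton :=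
    ((hasLogOn_compl_singleton hkc hk0 v).mono fun x hx hxv => hv (hxv ▸ hx)).congr
      fun x hx => if_pos hx
  obtain ⟨g, hg⟩ := E.exists_potential_of_hasLogOn hlog
  exact ⟨g, fun e => hg e (E.curve_subset_skeleton e)⟩

/-- One half of Euler's formula. -/
theorem card_edges_add_one_le [Fintype V] [Nonempty V] [Fintype G.edgeSet] [Nonempty G.edgeSet]
    [Fintype E.faces] :
    Fintype.card G.edgeSet + 1 ≤ Fintype.card V + Fintype.card E.faces := by
  choose φ hφc hφi hφ using fun f : E.faces => hT.exists_circle_eq_frontier f.2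
  have hm : ∀ f, MapsTo (φ f) (sphere 0 1) E.skeleton := fun f z hz => by
    have := hφ f ▸ mem_image_of_mem (φ f) hz
    rw [hT.frontier_face f.2] at this
    exact this.2
  refine card_add_one_le_of_ker_le_coboundary edgeSource edgeTarget
    (LinearMap.pi fun f => E.chainDegree (φ f) (hφc f) (hm f)) fun c hc => ?_
  refine hT.exists_potential (toFinite _) fun f hf => ?_
  have h0 : E.chainDegree (φ ⟨f, hf⟩) (hφc _) (hm _) c = 0 := congrFun hc ⟨f, hf⟩
  have := (E.hasLogOn_of_chainDegree_eq_zero _ _ h0).image_of_isCompact (isCompact_sphere 0 1)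
    (hφc _) (hφi _)
  rwa [hφ] at this

/-- A face has at least as many vertices as boundary edges. -/
theorem faceDegree_le_ncard [Finite V] [Finite G.edgeSet] [Nonempty G.edgeSet]
    {f : Set (sphere (0 : EuclideanSpace ℝ (Fin 3)) 1)} (hf : f ∈ E.faces) :
    E.faceDegree f ≤ {v | E.point v ∈ f}.ncard := by
  classical
  have := Fintype.ofFinite V
  have := Fintype.ofFinite G.edgeSet
  obtain ⟨φ, hφc, hφi, hφ⟩ := hT.exists_circle_eq_frontier hf
  have hm : MapsTo φ (sphere 0 1) E.skeleton := fun z hz => by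
    have := hφ ▸ mem_image_of_mem φ hz
    rw [hT.frontier_face hf] at this
    exact this.2
  have hsub : ∀ e : {e : G.edgeSet | E.curve e ⊆ frontier f}, E.curve e ⊆ f := fun e =>
    (hT.curve_subset_frontier_iff hf e).mp e.2
  obtain ⟨e₀, he₀⟩ := hT.exists_curve_subset_face hf (hT.infinite_frontier_face hf)
  have : Nonempty {v | E.point v ∈ f} := ⟨_, he₀ (E.point_source_mem_curve e₀)⟩
  have key := card_add_one_le_of_ker_le_coboundary
    (fun e : {e : G.edgeSet | E.curve e ⊆ frontier f} =>
      (⟨edgeSource e.1, hsub e (E.point_source_mem_curve e)⟩ : {v | E.point v ∈ f}))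
    (fun e => ⟨edgeTarget e.1, hsub e (E.point_target_mem_curve e)⟩)
    -- A single circle gives a target of rank 1, which cancels the `+ 1` of the rank count.
    (LinearMap.pi fun _ : Unit =>
      E.chainDegree φ hφc hm ∘ₗ Function.ExtendByZero.linearMap ℤ Subtype.val) (by
      intro c hc
      have h0 : E.chainDegree φ hφc hm (Function.ExtendByZero.linearMap ℤ Subtype.val c) = 0 :=
        congrFun hc ()
      have hlog := (E.hasLogOn_of_chainDegree_eq_zero _ _ h0).image_of_isCompact
        (isCompact_sphere 0 1) hφc hφi
      rw [hφ] at hlog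
      obtain ⟨g, hg⟩ := E.exists_potential_of_hasLogOn hlog
      refine ⟨fun v => g v, fun e => ?_⟩
      rw [← hg e e.2]
      exact (Subtype.val_injective.extend_apply c 0 e).symm)
  simp only [← Nat.card_eq_fintype_card, Nat.card_coe_set_eq, Nat.card_unique] at key
  exact Nat.le_of_add_le_add_right key

theorem faceDegree_pos [Finite V] [Finite G.edgeSet] [Nonempty G.edgeSet]
    {f : Set (sphere (0 : EuclideanSpace ℝ (Fin 3)) 1)} (hf : f ∈ E.faces) :
    0 < E.faceDegree f := by
  obtain ⟨e, he⟩ := hT.exists_curve_subset_face hf (hT.infinite_frontier_face hf)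
  exact (ncard_pos (toFinite _)).mpr ⟨e, (hT.curve_subset_frontier_iff hf e).mpr he⟩

theorem sum_curvature_pos [Fintype V] [Nonempty V] [Finite G.edgeSet] [Nonempty G.edgeSet] :
    0 < ∑ v, E.curvature v := by
  classical
  have hfin : E.faces.Finite := hT.finite_faces fun f hf =>
    hT.exists_curve_subset_face hf (hT.infinite_frontier_face hf)
  have := hfin.fintype
  have hdeg : ∑ v, (E.vertexDegree v : ℝ) = 2 * Fintype.card G.edgeSet := by
    have h := G.sum_degrees_eq_twice_card_edges
    rw [SimpleGraph.edgeFinset_card] at h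
    have hv : ∀ v, E.vertexDegree v = G.degree v := fun v => by
      rw [vertexDegree, ← Nat.card_coe_set_eq, Nat.card_eq_fintype_card,
        SimpleGraph.card_incidenceSet_eq_degree]
    simp only [hv]
    exact_mod_cast h
  have hface : (Fintype.card E.faces : ℝ) ≤
      ∑ v, ∑ᶠ f ∈ {f ∈ E.faces | E.point v ∈ f}, 1 / (E.faceDegree f : ℝ) := by
    have hv : ∀ v, ∑ᶠ f ∈ {f ∈ E.faces | E.point v ∈ f}, 1 / (E.faceDegree f : ℝ)
        = ∑ f ∈ E.faces.toFinset, if E.point v ∈ f then 1 / (E.faceDegree f : ℝ) else 0 := by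
      intro v
      rw [← Finset.sum_filter, ← finsum_mem_coe_finset]
      congr 1
      ext f
      simp
    simp only [hv]
    -- After exchanging the sums, each face contributes its number of vertices over its degree,
    -- which is at least 1.
    rw [Finset.sum_comm, ← Set.toFinset_card, Finset.card_eq_sum_ones, Nat.cast_sum]
    refine Finset.sum_le_sum fun f hf => ?_
    rw [Set.mem_toFinset] at hf
    have hpos : (0 : ℝ) < E.faceDegree f := by exact_mod_cast hT.faceDegree_pos hf
    have hle := hT.faceDegree_le_ncard hf
    rw [← Finset.sum_filter, Finset.sum_const, nsmul_eq_mul, Nat.cast_one, mul_one_div,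
      le_div_iff₀ hpos, one_mul]
    rw [ncard_eq_toFinset_card'] at hle
    exact_mod_cast hle.trans (Finset.card_le_card fun v => by simp)
  have heuler : (Fintype.card G.edgeSet : ℝ) + 1 ≤ Fintype.card V + Fintype.card E.faces := by
    exact_mod_cast hT.card_edges_add_one_le
  have hsum : ∑ v, E.curvature v = Fintype.card V - Fintype.card G.edgeSet +
      ∑ v, ∑ᶠ f ∈ {f ∈ E.faces | E.point v ∈ f}, 1 / (E.faceDegree f : ℝ) := by
    simp only [curvature, Finset.sum_add_distrib, Finset.sum_sub_distrib, ← Finset.sum_div, hdeg]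
    simp
  rw [hsum]
  linarith

end IsTessellation

end Sphere

end GraphEmbedding

/-! ### The theorem -/

theorem mainTheorem6 {V : Type*} (G : SimpleGraph V) (hG : G.Connected)
    (E : GraphEmbedding G (Metric.sphere (0 : EuclideanSpace ℝ (Fin 3)) 1))
    (hlc : E.IsLocallyCompact) (hT : E.IsTessellation) :
    ∃ v : V, 0 < E.curvature v := by
  have hV : Nonempty V := hG.nonempty
  rcases isEmpty_or_nonempty G.edgeSet with hE | hE
  · obtain ⟨v⟩ := hV
    have hd : E.vertexDegree v = 0 := by
      have h0 : G.incidenceSet v = ∅ := eq_empty_of_forall_notMem fun e he => hE.elim ⟨e, he.1⟩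
      rw [GraphEmbedding.vertexDegree, h0, ncard_empty]
    refine ⟨v, ?_⟩
    rw [GraphEmbedding.curvature, hd]
    -- Without edges the curvature is 1 plus this nonnegative sum.
    have : 0 ≤ ∑ᶠ f ∈ {f ∈ E.faces | E.point v ∈ f}, 1 / (E.faceDegree f : ℝ) :=
      finsum_nonneg fun f => finsum_nonneg fun _ => by positivity
    norm_num
    norm_num at this
    linarith
  · have hfin : Finite G.edgeSet := by
      refine finite_univ_iff.mp ((hlc univ isCompact_univ).subset fun e _ => ?_)
      exact ⟨_, E.point_source_mem_curve e, trivial⟩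
    have hVfin : Finite V := by
      refine finite_univ_iff.mp (((finite_range (GraphEmbedding.edgeSource (G := G))).union
        (finite_range (GraphEmbedding.edgeTarget (G := G)))).subset fun v _ => ?_)
      obtain ⟨e⟩ := hE
      have : Nontrivial V := ⟨_, _, (GraphEmbedding.adj_edgeSource_edgeTarget e).ne⟩
      obtain ⟨w, hw⟩ := hG.preconnected.exists_adj_of_nontrivial v
      have hv : v ∈ ((⟨s(v, w), hw⟩ : G.edgeSet) : Sym2 V) := Sym2.mem_mk_left v w
      rw [← GraphEmbedding.mk_edgeSource_edgeTarget, Sym2.mem_iff] at hv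
      exact hv.imp (fun h => ⟨_, h.symm⟩) fun h => ⟨_, h.symm⟩
    have := Fintype.ofFinite V
    obtain ⟨v, -, hv⟩ := Finset.exists_lt_of_sum_lt
      (s := Finset.univ) (f := fun _ : V => (0 : ℝ)) (g := E.curvature)
      (by simpa using hT.sum_curvature_pos)
    exact ⟨v, hv⟩
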